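/- Let $k=p_1p_2\cdots p_d$ with $d\ge 2$ be a product of pairwise distinct primes, and put $c_1=1$, $c_i=p_1\cdots p_{i-1}$ for $2\le i\le d$. For each $i$ let $g_i:\{0,\dots,p_i-1\}\times\mathbb Z\to\mathbb Z$ be an admissible function, i.e. $g_i(j,n)$ is periodic in $n$ with period $p_i$ and, for all $0\le u<v\le p_i-1$, $$\{(g_i(v,n)-g_i(u,n)) \bmod p_i : 0\le n\le p_i-1\}=\{0,1,\dots,p_i-1\},$$ and let $(a_i(n))_{n\ge0}$ be a sequence of integers with $$a_i(p_in+j)=a_i(n)+g_i(j,n)\qquad (n\ge 1,\ 0\le j\le p_i-1).$$ Let $\hat a(n)=\bigl(c_1a_1(n)+\cdots+c_da_d(n)\bigr)\bmod k\in\{0,\dots,k-1\}$, and let $\delta(m,n)=0$ if $\hat a(m)=\hat a(n)$ and $\delta(m,n)=1$ otherwise. Then for all integers $0\le r_1<r_2$, all real $0<\gamma<1$ and all integers $N\ge 0$, $$\sum_{n<N}\delta(n+r_1,n+r_2)=\Bigl(1-\frac1k\Bigr)N+O_k\Bigl((r_2-r_1)N^{1-\gamma/d}+(r_2-r_1)N^{1-\gamma}\log^+\frac{N^{\gamma/d}}{r_2-r_1}+N^{\gamma}+r_1\Bigr),$$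 where $\log^+x=\max(0,\log x)$ for $x>0$, $\log^+0=0$, and the implied constant depends only on $k$ (not on the $g_i$, the $a_i$, $\gamma$, $r_1$, $r_2$ or $N$). -/

import Mathlib

namespace RudinShapiro

/-- The discrete correlation coefficient of order two of a word `x`. -/
def delta (x : ℕ → ℤ) (i j : ℕ) : ℕ :=
  if x i = x j then 0 else 1

/-- `g : {0, …, k-1} × ℤ → ℤ` is admissible: it is `k`-periodic in its second argument, and for
all `u < v` the differences `g(v, n) - g(u, n)`, reduced mod `k`, `0 ≤ n ≤ k-1`, fill
`{0, …, k-1}`. -/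
structure Admissible (k : ℕ) (g : Fin k → ℤ → ℤ) : Prop where
  periodic : ∀ (j : Fin k) (n : ℤ), g j (n + k) = g j n
  differences : ∀ u v : Fin k, u < v →
    (fun n : ℤ => (g v n - g u n) % (k : ℤ)) '' Set.Ico (0 : ℤ) k = Set.Ico (0 : ℤ) k

/-- The digit recursion in base `k`; the initial values `a 0, …, a (k-1)` are arbitrary. -/
def DigitRecursion (k : ℕ) (g : Fin k → ℤ → ℤ) (a : ℕ → ℤ) : Prop :=
  ∀ n : ℕ, 1 ≤ n → ∀ j : Fin k, a (k * n + j) = a n + g j n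

/-- The weight of index `i`: the product of the `p j` with `j < i` (an empty product is `1`). -/
def weight {d : ℕ} (p : Fin d → ℕ) (i : Fin d) : ℕ :=
  ∏ j ∈ Finset.Iio i, p j

/-- The combined sequence: the weighted sum of the `a i`, reduced modulo the product of
the `p i`. -/
def combined {d : ℕ} (p : Fin d → ℕ) (a : Fin d → ℕ → ℤ) (n : ℕ) : ℤ :=
  (∑ i, (weight p i : ℤ) * a i n) % ((∏ i, p i : ℕ) : ℤ)

end RudinShapiro

/-!
Let `r = r₂ - r₁` and fix window lengths `W i`. Call `n` good if, for every `i`, adding `r` to `n`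
produces no carry past the last `W i` digits in base `p i`. For good `n` the increment
`a i (n + r) - a i n` depends only on `n` modulo `p i ^ (W i + 1)`, and over the good residues it is
equidistributed modulo `p i`: at the highest position where the digits of `n` and `n + r` differ,
admissibility makes the increment run through all residues as the next higher digit varies. Since
the `p i` are pairwise coprime, the Chinese remainder theorem makes these increments independent,
and the mixed radix weights combine them into one increment equidistributed modulo `k`. Hence the
good `n` in a window of length `∏ i, p i ^ (W i + 1)` contribute exactly `1 - 1 / k` on average,
while at most `r * (N / p i ^ W i + 1)` of `N` consecutive integers are bad for `i`. Taking
`p i ^ W i` of size `N ^ (γ / d)` turns these two errors into `N ^ γ` and `r * N ^ (1 - γ / d)`.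
-/

namespace RudinShapiro

open Finset

section Equidistribution

variable {α β : Type*} {m n : ℕ}

/-- The values of `b` on the finite set `s` are uniformly distributed over the residue classes
modulo `m`. The cardinality of the class is multiplied by `m` so that no division occurs. -/
def EquidistributedMod (m : ℕ) (s : Finset α) (b : α → ℤ) : Prop :=
  ∀ z : ℤ, #{x ∈ s | b x ≡ z [ZMOD m]} * m = #s

theorem EquidistributedMod.empty (b : α → ℤ) : EquidistributedMod m ∅ b := by
  simp [EquidistributedMod]

theorem bijOn_filter {s : Finset α} {t : Finset β} {φ : α → β} (hφ : Set.BijOn φ s t)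
    {P : α → Prop} {Q : β → Prop} [DecidablePred P] [DecidablePred Q]
    (h : ∀ x ∈ s, P x ↔ Q (φ x)) :
    Set.BijOn φ ({x ∈ s | P x} : Finset α) ({y ∈ t | Q y} : Finset β) := by
  simp only [coe_filter]
  refine ⟨fun x hx => ⟨hφ.mapsTo hx.1, (h x hx.1).1 hx.2⟩, hφ.injOn.mono fun x hx => hx.1,
    fun y hy => ?_⟩
  obtain ⟨x, hx, rfl⟩ := hφ.surjOn hy.1
  exact ⟨x, ⟨hx, (h x hx).2 hy.2⟩, rfl⟩

theorem EquidistributedMod.of_bijOn {s : Finset α} {t : Finset β} {b : α → ℤ} {c : β → ℤ}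
    (h : EquidistributedMod m t c) {φ : α → β} (hφ : Set.BijOn φ s t)
    (hb : ∀ x ∈ s, b x ≡ c (φ x) [ZMOD m]) : EquidistributedMod m s b := by
  intro z
  have hclass := bijOn_filter (P := fun x => b x ≡ z [ZMOD m]) (Q := fun y => c y ≡ z [ZMOD m]) hφ
    fun x hx => ⟨(hb x hx).symm.trans, (hb x hx).trans⟩
  rw [hφ.finsetCard_eq, ← h z, hclass.finsetCard_eq]

theorem EquidistributedMod.congr {s : Finset α} {b c : α → ℤ} (h : EquidistributedMod m s c)
    (hb : ∀ x ∈ s, b x = c x) : EquidistributedMod m s b :=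
  h.of_bijOn (Set.bijOn_id _) fun x hx => hb x hx ▸ Int.ModEq.rfl

theorem EquidistributedMod.add_const {s : Finset α} {b : α → ℤ} (h : EquidistributedMod m s b)
    (c : ℤ) : EquidistributedMod m s fun x => b x + c := by
  intro z
  rw [← h (z - c)]
  congr! 3 with x
  simp only [Int.modEq_iff_dvd, sub_sub, add_comm]

theorem EquidistributedMod.of_filter {s : Finset α} {b : α → ℤ} (P : α → Prop) [DecidablePred P]
    (hP : EquidistributedMod m {x ∈ s | P x} b) (hn : EquidistributedMod m {x ∈ s | ¬ P x} b) :
    EquidistributedMod m s b := by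
  intro z
  rw [← card_filter_add_card_filter_not (s := s) P, ← hP z, ← hn z, filter_comm,
    filter_comm (fun x => ¬ P x), ← Nat.add_mul, card_filter_add_card_filter_not]

theorem EquidistributedMod.product_left {s : Finset α} {t : Finset β} {b : α × β → ℤ}
    (h : ∀ y ∈ t, EquidistributedMod m s fun x => b (x, y)) : EquidistributedMod m (s ×ˢ t) b := by
  intro z
  simp only [EquidistributedMod, card_filter] at h ⊢
  rw [sum_product_right, sum_mul, sum_congr rfl fun y hy => h y hy z, card_product, sum_const,
    smul_eq_mul, mul_comm]

theorem EquidistributedMod.product_right {s : Finset α} {t : Finset β} {b : α × β → ℤ}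
    (h : ∀ x ∈ s, EquidistributedMod m t fun y => b (x, y)) : EquidistributedMod m (s ×ˢ t) b := by
  intro z
  simp only [EquidistributedMod, card_filter] at h ⊢
  rw [sum_product, sum_mul, sum_congr rfl fun x hx => h x hx z, card_product, sum_const,
    smul_eq_mul]

theorem EquidistributedMod.of_card_eq_of_forall_exists {s : Finset α} {b : α → ℤ} (hs : #s = m)
    (hb : ∀ z : ℤ, ∃ x ∈ s, b x ≡ z [ZMOD m]) : EquidistributedMod m s b := by
  have hm : (0 : ℤ) < m := by
    obtain ⟨x, hx, -⟩ := hb 0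
    exact_mod_cast hs ▸ card_pos.2 ⟨x, hx⟩
  have hmaps : Set.MapsTo (fun x => b x % m) s (Ico (0 : ℤ) m) := fun x _ =>
    mem_coe.2 (mem_Ico.2 ⟨Int.emod_nonneg _ hm.ne', Int.emod_lt_of_pos _ hm⟩)
  have hsurj : Set.SurjOn (fun x => b x % m) s (Ico (0 : ℤ) m) := by
    intro z hz
    obtain ⟨x, hx, hxz⟩ := hb z
    obtain ⟨hz₀, hz₁⟩ := mem_Ico.1 (mem_coe.1 hz)
    exact ⟨x, hx, Eq.trans hxz (Int.emod_eq_of_lt hz₀ hz₁)⟩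
  have hinj := injOn_of_surjOn_of_card_le _ hmaps hsurj (by simp [hs])
  intro z
  obtain ⟨x₀, hx₀, hxz⟩ := hb z
  have hclass : {x ∈ s | b x ≡ z [ZMOD m]} = {x₀} := by
    ext x
    rw [mem_filter, mem_singleton]
    refine ⟨fun ⟨hx, h⟩ => hinj hx hx₀ (h.trans hxz.symm), ?_⟩
    rintro rfl
    exact ⟨hx₀, hxz⟩
  rw [hclass, card_singleton, one_mul, hs]

theorem add_mul_modEq_mul_iff (hm : m ≠ 0) {b c z : ℤ} :
    b + m * c ≡ z [ZMOD (m * n : ℕ)] ↔ b ≡ z [ZMOD m] ∧ c ≡ (z - b) / m [ZMOD n] := by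
  have hm' : (m : ℤ) ≠ 0 := Nat.cast_ne_zero.2 hm
  have hdvd (h : b ≡ z [ZMOD m]) :
      b + m * c ≡ z [ZMOD (m * n : ℕ)] ↔ c ≡ (z - b) / m [ZMOD n] := by
    obtain ⟨t, ht⟩ := h.dvd
    rw [ht, Int.mul_ediv_cancel_left _ hm', Int.modEq_iff_dvd, Int.modEq_iff_dvd, ← sub_sub, ht,
      ← mul_sub, Nat.cast_mul, mul_dvd_mul_iff_left hm']
  refine ⟨fun h => ?_, fun h => (hdvd h.1).2 h.2⟩
  have hb : b ≡ z [ZMOD m] := by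
    have h' : b + m * c ≡ z [ZMOD m] := Int.ModEq.of_mul_right n (by exact_mod_cast h)
    exact (Int.modEq_iff_dvd.2 ⟨c, add_sub_cancel_left b _⟩).trans h'
  exact ⟨hb, (hdvd hb).1 h⟩

theorem EquidistributedMod.add_mul {s : Finset α} {t : Finset β} {b : α → ℤ} {c : β → ℤ}
    (hb : EquidistributedMod m s b) (hc : EquidistributedMod n t c) (hm : m ≠ 0) :
    EquidistributedMod (m * n) (s ×ˢ t) fun x => b x.1 + m * c x.2 := by
  intro z
  calc #{x ∈ s ×ˢ t | b x.1 + m * c x.2 ≡ z [ZMOD (m * n : ℕ)]} * (m * n)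
      = (∑ x ∈ s with b x ≡ z [ZMOD m], #{y ∈ t | c y ≡ (z - b x) / m [ZMOD n]} * n) * m := by
        simp only [add_mul_modEq_mul_iff hm, card_filter, sum_product, sum_filter, ite_and,
          sum_mul]
        refine sum_congr rfl fun x _ => ?_
        split_ifs <;> simp [sum_mul, mul_comm m n]
    _ = #{x ∈ s | b x ≡ z [ZMOD m]} * m * #t := by
        rw [sum_congr rfl fun x _ => hc _, sum_const, smul_eq_mul]
        ring
    _ = #(s ×ˢ t) := by rw [hb z, card_product]

end Equidistribution

section Weight

variable {d : ℕ}

theorem weight_zero (p : Fin (d + 1) → ℕ) : weight p 0 = 1 := by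
  have : Iio (0 : Fin (d + 1)) = ∅ := Iio_eq_empty.2 fun i _ => Fin.zero_le i
  rw [weight, this, prod_empty]

theorem weight_succ (p : Fin (d + 1) → ℕ) (i : Fin d) :
    weight p i.succ = p 0 * weight (fun j => p j.succ) i := by
  have : Iio i.succ = cons 0 ((Iio i).map (Fin.succEmb d)) (by simp) := by
    ext j
    cases j using Fin.cases <;> simp
  rw [weight, this, prod_cons, prod_map]
  rfl

theorem combined_eq_combined_iff (p : Fin d → ℕ) (a : Fin d → ℕ → ℤ) (m n : ℕ) :
    combined p a m = combined p a n ↔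
      ∑ i, (weight p i : ℤ) * (a i n - a i m) ≡ 0 [ZMOD (∏ i, p i : ℕ)] := by
  simp_rw [mul_sub, sum_sub_distrib]
  rw [Int.modEq_zero_iff_dvd, ← Int.modEq_iff_dvd]
  rfl

theorem EquidistributedMod.sum_weight_mul {p : Fin d → ℕ} (hp : ∀ i, p i ≠ 0)
    {α : Fin d → Type*} {s : ∀ i, Finset (α i)} {b : ∀ i, α i → ℤ}
    (h : ∀ i, EquidistributedMod (p i) (s i) (b i)) :
    EquidistributedMod (∏ i, p i) (Fintype.piFinset s)
      fun x => ∑ i, (weight p i : ℤ) * b i (x i) := by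
  induction d with
  | zero => intro z; simp [Int.modEq_one]
  | succ d ih =>
    have htail := ih (fun i => hp i.succ) fun i => h i.succ
    rw [Fin.prod_univ_succ]
    refine ((h 0).add_mul htail (hp 0)).of_bijOn (φ := (Fin.consEquiv α).symm)
      ((Fin.consEquiv α).symm.bijOn fun x => ?_) fun x _ => ?_
    · simp [Fin.consEquiv, Fin.tail, Fin.forall_fin_succ]
    · simp [Fin.consEquiv, Fin.tail, Fin.sum_univ_succ, weight_zero, weight_succ, mul_sum,
        mul_assoc]

end Weight

section Digits

theorem bijOn_mod_div (q p : ℕ) :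
    Set.BijOn (fun n => (n % q, n / q)) (range (q * p)) (range q ×ˢ range p : Finset (ℕ × ℕ)) := by
  refine ⟨fun n hn => ?_, fun m _ n _ hmn => ?_, fun ⟨x, y⟩ hxy => ?_⟩
  · have hn : n < q * p := by simpa using hn
    have hq : 0 < q := Nat.pos_of_mul_pos_right (n.zero_le.trans_lt hn)
    simpa using ⟨Nat.mod_lt n hq, Nat.div_lt_of_lt_mul hn⟩
  · rw [← Nat.div_add_mod m q, ← Nat.div_add_mod n q, (Prod.mk.inj hmn).1, (Prod.mk.inj hmn).2]
  · obtain ⟨hx, hy⟩ : x < q ∧ y < p := by simpa using hxy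
    refine ⟨q * y + x, ?_, ?_⟩
    · rw [mem_coe, mem_range]
      calc q * y + x < q * (y + 1) := by rw [mul_add_one]; omega
        _ ≤ q * p := Nat.mul_le_mul_left q hy
    · simp [Nat.mul_add_div (x.zero_le.trans_lt hx), Nat.mod_eq_of_lt hx, Nat.div_eq_of_lt hx]

theorem bijOn_mod_pi {ι : Type*} [Fintype ι] [DecidableEq ι] {q : ι → ℕ} (hq : ∀ i, q i ≠ 0)
    (hco : Pairwise (Function.onFun Nat.Coprime q)) (s : ℕ) :
    Set.BijOn (fun n i => n % q i) (Ico s (s + ∏ i, q i))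
      (Fintype.piFinset fun i => range (q i)) := by
  have hmaps : Set.MapsTo (fun n i => n % q i) (Ico s (s + ∏ i, q i))
      (Fintype.piFinset fun i => range (q i)) := fun n _ =>
    mem_coe.2 (Fintype.mem_piFinset.2 fun i => mem_range.2 (Nat.mod_lt _ (hq i).bot_lt))
  have hinj : Set.InjOn (fun n i => n % q i) (Ico s (s + ∏ i, q i) : Finset ℕ) := by
    intro m hm n hn hmn
    have hdvd : ((∏ i, q i : ℕ) : ℤ) ∣ n - m := by
      rw [Nat.cast_prod]
      exact prod_dvd_of_coprime (fun i _ j _ hij => Nat.isCoprime_iff_coprime.2 (hco hij))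
        fun i _ => Nat.modEq_iff_dvd.1 (congrFun hmn i)
    refine (Nat.modEq_iff_dvd.2 hdvd).eq_of_abs_lt ?_
    rw [mem_coe, mem_Ico] at hm hn
    rw [abs_lt]
    omega
  exact ⟨hmaps, hinj, surjOn_of_injOn_of_card_le _ hmaps hinj (by simp)⟩

/-- Adding `r` to `n` produces no carry past the digits counted by `q`: for `q = p ^ W` the base
`p` expansions of `n` and `n + r` agree from digit `W` on. -/
abbrev NoCarry (q r n : ℕ) : Prop :=
  (n + r) / q = n / q

theorem noCarry_iff_mod_add_lt {q r n : ℕ} (hq : 0 < q) : NoCarry q r n ↔ n % q + r < q := by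
  rw [NoCarry, ← Nat.div_eq_zero_iff_lt hq]
  conv_lhs => rw [← Nat.div_add_mod n q, add_assoc, Nat.mul_add_div hq, Nat.mul_add_div hq]
  simp

theorem noCarry_iff_of_modEq {q r m n : ℕ} (hq : 0 < q) (hmn : m ≡ n [MOD q]) :
    NoCarry q r m ↔ NoCarry q r n := by
  rw [noCarry_iff_mod_add_lt hq, noCarry_iff_mod_add_lt hq, hmn]

theorem NoCarry.mul {q r n : ℕ} (h : NoCarry q r n) (p : ℕ) : NoCarry (q * p) r n := by
  rw [NoCarry, ← Nat.div_div_eq_div_mul, h, Nat.div_div_eq_div_mul]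

theorem EquidistributedMod.noCarry_mul {m q₀ q p r : ℕ} {b : ℕ → ℤ} (hdvd : q₀ ∣ q) (hq : 0 < q)
    (hlow : ∀ y, EquidistributedMod m {x ∈ range q | NoCarry q₀ r x} fun x => b (q * y + x))
    (htop : ∀ x, x + r < q → ¬ NoCarry q₀ r x →
      EquidistributedMod m (range p) fun y => b (q * y + x)) :
    EquidistributedMod m {n ∈ range (q * p) | NoCarry q r n} b := by
  obtain ⟨t, rfl⟩ := hdvd
  have hiff {x : ℕ} (hx : x < q₀ * t) : NoCarry (q₀ * t) r x ↔ x + r < q₀ * t := by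
    rw [noCarry_iff_mod_add_lt hq, Nat.mod_eq_of_lt hx]
  have hprod : EquidistributedMod m ({x ∈ range (q₀ * t) | NoCarry (q₀ * t) r x} ×ˢ range p)
      fun xy => b (q₀ * t * xy.2 + xy.1) := by
    refine .of_filter (fun xy => NoCarry q₀ r xy.1) ?_ ?_
    · rw [filter_product_left (fun x => NoCarry q₀ r x), filter_filter,
        filter_congr fun x _ => and_iff_right_of_imp fun h : NoCarry q₀ r x => h.mul t]
      exact .product_left fun y _ => hlow y
    · rw [filter_product_left (fun x => ¬ NoCarry q₀ r x)]
      refine .product_right fun x hx => ?_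
      simp only [mem_filter, mem_range] at hx
      exact htop x ((hiff hx.1.1).1 hx.1.2) hx.2
  rw [← filter_product_left] at hprod
  refine hprod.of_bijOn (bijOn_filter (bijOn_mod_div (q₀ * t) p) fun n _ => ?_) fun n _ => ?_
  · exact noCarry_iff_of_modEq hq (Nat.mod_modEq n _).symm
  · rw [Nat.div_add_mod]

theorem sum_range_add_shift {M : Type*} [AddCommMonoid M] (f : ℕ → M) (m n : ℕ) :
    ∑ i ∈ range n, f (m + i) + ∑ i ∈ range m, f i =
      ∑ i ∈ range m, f (n + i) + ∑ i ∈ range n, f i := by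
  rw [add_comm, ← sum_range_add, add_comm m, sum_range_add, add_comm]

/-- The count is bounded by a sum of increments of `n ↦ n / q`, which telescopes. -/
theorem card_not_noCarry_le (q r s N : ℕ) :
    #{n ∈ Ico s (s + N) | ¬ NoCarry q r n} ≤ r * (N / q + 1) := by
  have hcarry (n : ℕ) : (if ¬ NoCarry q r n then 1 else 0) + n / q ≤ (n + r) / q := by
    have : n / q ≤ (n + r) / q := Nat.div_le_div_right (Nat.le_add_right n r)
    split_ifs <;> omega
  have hstep (n : ℕ) : (s + (N + n)) / q ≤ (s + n) / q + (N / q + 1) := by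
    rcases q.eq_zero_or_pos with rfl | hq
    · simp
    · rw [add_left_comm, Nat.add_div hq]
      split_ifs <;> omega
  have htele := sum_range_add_shift (fun n => (s + n) / q) r N
  have hshort := sum_le_sum fun n (_ : n ∈ range r) => hstep n
  have hlong := sum_le_sum fun n (_ : n ∈ range N) => hcarry (s + n)
  rw [sum_add_distrib] at hshort hlong
  rw [sum_const, card_range, smul_eq_mul] at hshort
  rw [card_filter, sum_Ico_eq_sum_range, Nat.add_sub_cancel_left]
  simp only [add_assoc, add_comm r] at *
  omega

theorem card_not_forall_noCarry_le {ι : Type*} [Fintype ι] (q : ι → ℕ) (r s N : ℕ) :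
    #{n ∈ Ico s (s + N) | ¬ ∀ i, NoCarry (q i) r n} ≤ ∑ i, r * (N / q i + 1) := by
  classical
  have hunion : {n ∈ Ico s (s + N) | ¬ ∀ i, NoCarry (q i) r n} =
      univ.biUnion fun i => {n ∈ Ico s (s + N) | ¬ NoCarry (q i) r n} := by
    ext n
    simp
  rw [hunion]
  exact card_biUnion_le.trans (sum_le_sum fun i _ => card_not_noCarry_le _ _ _ _)

end Digits

section DigitRecursion

variable {p : ℕ} {g : Fin p → ℤ → ℤ} {a : ℕ → ℤ}

theorem Admissible.eq_of_modEq (hg : Admissible p g) (j : Fin p) {m n : ℤ}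
    (h : m ≡ n [ZMOD p]) : g j m = g j n := by
  obtain ⟨t, ht⟩ := h.dvd
  have hper : Function.Periodic (g j) (p : ℤ) := hg.periodic j
  rw [← hper.int_mul t m, Int.cast_id, mul_comm, ← ht, add_sub_cancel]

theorem Admissible.equidistributedMod_sub (hg : Admissible p g) {u v : Fin p} (huv : u < v) :
    EquidistributedMod p (range p) fun y => g v y - g u y := by
  have hp : (0 : ℤ) < p := by exact_mod_cast u.pos
  refine .of_card_eq_of_forall_exists (card_range p) fun z => ?_
  obtain ⟨n, ⟨hn₀, hn₁⟩, hn⟩ : z % p ∈ (fun n : ℤ => (g v n - g u n) % p) '' Set.Ico 0 (p : ℤ) :=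
    (hg.differences u v huv).symm ▸ ⟨Int.emod_nonneg z hp.ne', Int.emod_lt_of_pos z hp⟩
  lift n to ℕ using hn₀
  exact ⟨n, mem_range.2 (by exact_mod_cast hn₁), hn⟩

theorem DigitRecursion.apply_eq (ha : DigitRecursion p g a) (hp : 0 < p) {n : ℕ} (hn : p ≤ n) :
    a n = a (n / p) + g ⟨n % p, Nat.mod_lt n hp⟩ (n / p : ℕ) := by
  rw [← ha (n / p) (Nat.div_pos hn hp), Nat.div_add_mod]

theorem DigitRecursion.sub_div_pow_eq (hg : Admissible p g) (ha : DigitRecursion p g a)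
    (hp : 0 < p) {L m n : ℕ} (hm : p ^ L ≤ m) (hn : p ^ L ≤ n) (hmn : m ≡ n [MOD p ^ (L + 1)]) :
    a m - a (m / p ^ L) = a n - a (n / p ^ L) := by
  induction L generalizing m n with
  | zero => simp
  | succ L ih =>
    have hle {m : ℕ} (hm : p ^ (L + 1) ≤ m) : p ≤ m ∧ p ^ L ≤ m / p :=
      ⟨(Nat.le_self_pow L.succ_ne_zero p).trans hm,
        (Nat.le_div_iff_mul_le hp).2 (by rwa [← pow_succ])⟩
    have hdiv : m / p ≡ n / p [MOD p ^ (L + 1)] := by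
      rw [pow_succ'] at hmn
      rw [Nat.ModEq, ← Nat.mod_mul_right_div_self, hmn, Nat.mod_mul_right_div_self]
    have hdigit : m % p = n % p := hmn.of_dvd (dvd_pow_self p (by omega))
    have hg' : g ⟨m % p, Nat.mod_lt m hp⟩ (m / p : ℕ) = g ⟨n % p, Nat.mod_lt n hp⟩ (n / p : ℕ) := by
      simp only [hdigit]
      exact hg.eq_of_modEq _
        (Int.natCast_modEq_iff.2 (hdiv.of_dvd (dvd_pow_self p L.succ_ne_zero)))
    have := ih (hle hm).2 (hle hn).2 hdiv
    rw [Nat.div_div_eq_div_mul, Nat.div_div_eq_div_mul, ← pow_succ'] at this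
    rw [ha.apply_eq hp (hle hm).1, ha.apply_eq hp (hle hn).1, hg']
    linarith

theorem DigitRecursion.increment_eq_of_noCarry (hg : Admissible p g) (ha : DigitRecursion p g a)
    (hp : 0 < p) {W r m n : ℕ} (hm : p ^ W ≤ m) (hn : p ^ W ≤ n) (hmn : m ≡ n [MOD p ^ (W + 1)])
    (hcarry : NoCarry (p ^ W) r m) : a (m + r) - a m = a (n + r) - a n := by
  have hcarry' : NoCarry (p ^ W) r n := (noCarry_iff_of_modEq (pow_pos hp W)
    (hmn.of_dvd (pow_dvd_pow p W.le_succ))).1 hcarry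
  have h := ha.sub_div_pow_eq hg hp hm hn hmn
  have h' := ha.sub_div_pow_eq hg hp (hm.trans (Nat.le_add_right m r))
    (hn.trans (Nat.le_add_right n r)) (hmn.add_right r)
  rw [hcarry, hcarry'] at h'
  linarith

theorem DigitRecursion.exists_eq_add_const (hg : Admissible p g) (ha : DigitRecursion p g a)
    (hp : 0 < p) (W : ℕ) {x : ℕ} (hx : x / p ^ W < p) :
    ∃ c : ℤ, ∀ m : ℕ, 1 ≤ m → a (p ^ (W + 1) * m + x) = a m + g ⟨x / p ^ W, hx⟩ m + c := by
  have hdiv (m : ℕ) : (p ^ (W + 1) * m + x) / p ^ W = p * m + x / p ^ W := by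
    rw [pow_succ, mul_assoc, Nat.mul_add_div (pow_pos hp W)]
  have hle {m : ℕ} (hm : 1 ≤ m) : p ^ W ≤ p ^ (W + 1) * m + x :=
    (Nat.pow_le_pow_right hp W.le_succ).trans
      ((Nat.le_mul_of_pos_right _ hm).trans (Nat.le_add_right _ _))
  refine ⟨a (p ^ (W + 1) * 1 + x) - a ((p ^ (W + 1) * 1 + x) / p ^ W), fun m hm => ?_⟩
  rw [← ha.sub_div_pow_eq hg hp (hle hm) (hle le_rfl) (by simp [Nat.ModEq]), hdiv,
    ← ha m hm ⟨x / p ^ W, hx⟩]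
  ring

theorem DigitRecursion.equidistributedMod_of_carry (hg : Admissible p g)
    (ha : DigitRecursion p g a) (hp : 0 < p) {W r x v : ℕ} (hx : x + r < p ^ (W + 1))
    (hcarry : ¬ NoCarry (p ^ W) r x) (hv : 1 ≤ v) :
    EquidistributedMod p (range p) fun y =>
      a (p ^ (W + 1) * (p * v + y) + x + r) - a (p ^ (W + 1) * (p * v + y) + x) := by
  have hdigit {x : ℕ} (hx : x < p ^ (W + 1)) : x / p ^ W < p := Nat.div_lt_of_lt_mul hx
  have hx' : x < p ^ (W + 1) := (Nat.le_add_right x r).trans_lt hx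
  obtain ⟨c, hc⟩ := ha.exists_eq_add_const hg hp W (hdigit hx')
  obtain ⟨c', hc'⟩ := ha.exists_eq_add_const hg hp W (hdigit hx)
  have hlt : (⟨x / p ^ W, hdigit hx'⟩ : Fin p) < ⟨(x + r) / p ^ W, hdigit hx⟩ :=
    lt_of_le_of_ne (Nat.div_le_div_right (Nat.le_add_right x r)) fun h =>
      hcarry (Fin.mk.inj_iff.1 h).symm
  refine ((hg.equidistributedMod_sub hlt).add_const (c' - c)).congr fun y _ => ?_
  have hm : 1 ≤ p * v + y := (Nat.mul_pos hp hv).trans_le (Nat.le_add_right _ _)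
  have hmod : ((p * v + y : ℕ) : ℤ) ≡ y [ZMOD p] := by simp
  rw [add_assoc, hc _ hm, hc' _ hm, hg.eq_of_modEq _ hmod, hg.eq_of_modEq _ hmod]
  ring

theorem DigitRecursion.equidistributedMod_of_noCarry (hg : Admissible p g)
    (ha : DigitRecursion p g a) (hp : 0 < p) {r : ℕ} (hr : r ≠ 0) (W : ℕ) {v : ℕ} (hv : 1 ≤ v) :
    EquidistributedMod p {x ∈ range (p ^ (W + 1)) | NoCarry (p ^ W) r x} fun x =>
      a (p ^ (W + 1) * v + x + r) - a (p ^ (W + 1) * v + x) := by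
  induction W generalizing v with
  | zero => simpa [NoCarry, hr] using EquidistributedMod.empty _
  | succ W ih =>
    have hpos (y : ℕ) : 1 ≤ p * v + y := (Nat.mul_pos hp hv).trans_le (Nat.le_add_right _ _)
    have hsplit (x y : ℕ) :
        p ^ (W + 1 + 1) * v + (p ^ (W + 1) * y + x) = p ^ (W + 1) * (p * v + y) + x := by
      ring
    rw [pow_succ p (W + 1)]
    refine .noCarry_mul (pow_dvd_pow p W.le_succ) (pow_pos hp _) (fun y => ?_) fun x hx hcarry => ?_
    · simpa only [← pow_succ, hsplit] using ih (hpos y)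
    · simpa only [← pow_succ, hsplit] using ha.equidistributedMod_of_carry hg hp hx hcarry hv

end DigitRecursion

section Correlation

theorem norm_sum_Ico_le_of_forall_window {E : Type*} [SeminormedAddCommGroup E] {f : ℕ → E}
    (hf : ∀ n, ‖f n‖ ≤ 1) {M Q : ℕ} (hQ : 0 < Q)
    (hwindow : ∀ s, M ≤ s → ∑ n ∈ Ico s (s + Q), f n = 0) (s t : ℕ) :
    ‖∑ n ∈ Ico s t, f n‖ ≤ M + Q := by
  have hcard (u : Finset ℕ) : ‖∑ n ∈ u, f n‖ ≤ #u :=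
    (norm_sum_le_of_le u fun n _ => hf n).trans_eq (by simp)
  have hlate (s : ℕ) (hs : M ≤ s) : ‖∑ n ∈ Ico s t, f n‖ ≤ Q := by
    induction hN : t - s using Nat.strong_induction_on generalizing s with
    | _ N ih =>
      rcases le_total t (s + Q) with hle | hle
      · refine (hcard _).trans (Nat.cast_le.2 ?_)
        rw [Nat.card_Ico]
        omega
      · rw [← sum_Ico_consecutive f (Nat.le_add_right s Q) hle, hwindow s hs, zero_add]
        rcases hle.eq_or_lt with rfl | hlt
        · simp
        · exact ih _ (by omega) (s + Q) (by omega) rfl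
  rw [← sum_filter_add_sum_filter_not (Ico s t) (· < M)]
  simp only [not_lt, Ico_filter_lt, Ico_filter_le]
  refine (norm_add_le _ _).trans (add_le_add ((hcard _).trans (Nat.cast_le.2 ?_))
    (hlate _ (le_max_right s M)))
  rw [Nat.card_Ico]
  omega

theorem abs_delta_sub_le (x : ℕ → ℤ) (i j k : ℕ) : |(delta x i j : ℝ) - (1 - 1 / k)| ≤ 1 := by
  have hk₀ : 0 ≤ 1 / (k : ℝ) := by positivity
  have hk₁ : 1 / (k : ℝ) ≤ 1 := by simpa using Nat.cast_inv_le_one k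
  rw [delta, abs_le]
  split_ifs <;> push_cast <;> constructor <;> linarith

variable {d : ℕ} {p : Fin d → ℕ} {g : (i : Fin d) → Fin (p i) → ℤ → ℤ} {a : Fin d → ℕ → ℤ}

theorem equidistributedMod_sum_weight_mul_sub (hp : ∀ i, 0 < p i)
    (hco : Pairwise (Function.onFun Nat.Coprime p)) (hg : ∀ i, Admissible (p i) (g i))
    (ha : ∀ i, DigitRecursion (p i) (g i) (a i)) {W : Fin d → ℕ} {r s : ℕ} (hr : r ≠ 0)
    (hs : ∀ i, p i ^ W i ≤ s) :
    EquidistributedMod (∏ i, p i)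
      {n ∈ Ico s (s + ∏ i, p i ^ (W i + 1)) | ∀ i, NoCarry (p i ^ W i) r n}
      fun n => ∑ i, (weight p i : ℤ) * (a i (n + r) - a i n) := by
  have hprod := EquidistributedMod.sum_weight_mul (fun i => (hp i).ne') fun i =>
    (ha i).equidistributedMod_of_noCarry (hg i) (hp i) hr (W i) le_rfl
  have hpi : Fintype.piFinset (fun i => {x ∈ range (p i ^ (W i + 1)) | NoCarry (p i ^ W i) r x}) =
      {x ∈ Fintype.piFinset fun i => range (p i ^ (W i + 1)) |
        ∀ i, NoCarry (p i ^ W i) r (x i)} := by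
    ext x
    simp only [Fintype.mem_piFinset, mem_filter, forall_and]
  rw [hpi] at hprod
  have hbij := bijOn_mod_pi (fun i => (pow_pos (hp i) (W i + 1)).ne')
    (fun i j hij => (hco hij).pow _ _) s
  refine hprod.of_bijOn (bijOn_filter hbij fun n _ => forall_congr' fun i => ?_) fun n hn => ?_
  · exact noCarry_iff_of_modEq (pow_pos (hp i) _)
      ((Nat.mod_modEq n _).symm.of_dvd (pow_dvd_pow _ (W i).le_succ))
  · simp only [mem_filter, mem_Ico] at hn
    have hinc (i) : a i (n + r) - a i n =
        a i (p i ^ (W i + 1) * 1 + n % p i ^ (W i + 1) + r) -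
          a i (p i ^ (W i + 1) * 1 + n % p i ^ (W i + 1)) :=
      (ha i).increment_eq_of_noCarry (hg i) (hp i) ((hs i).trans hn.1.1)
        ((Nat.pow_le_pow_right (hp i) (W i).le_succ).trans (by simp)) (by simp [Nat.ModEq])
        (hn.2 i)
    simp only [hinc]
    rfl

theorem sum_delta_sub_filter_noCarry_eq_zero (hp : ∀ i, 0 < p i)
    (hco : Pairwise (Function.onFun Nat.Coprime p)) (hg : ∀ i, Admissible (p i) (g i))
    (ha : ∀ i, DigitRecursion (p i) (g i) (a i)) {W : Fin d → ℕ} {r s : ℕ} (hr : r ≠ 0)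
    (hs : ∀ i, p i ^ W i ≤ s) :
    ∑ n ∈ Ico s (s + ∏ i, p i ^ (W i + 1)) with ∀ i, NoCarry (p i ^ W i) r n,
      ((delta (combined p a) n (n + r) : ℝ) - (1 - 1 / (∏ i, p i : ℕ))) = 0 := by
  have hk : ((∏ i, p i : ℕ) : ℝ) ≠ 0 := Nat.cast_ne_zero.2 (prod_pos fun i _ => hp i).ne'
  have hdelta (n : ℕ) : (delta (combined p a) n (n + r) : ℝ) =
      1 - if combined p a n = combined p a (n + r) then 1 else 0 := by
    rw [delta]
    split_ifs <;> simp
  have hcount := equidistributedMod_sum_weight_mul_sub hp hco hg ha hr hs 0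
  simp only [← combined_eq_combined_iff] at hcount
  simp only [hdelta, sub_sub_sub_cancel_left, sum_sub_distrib, sum_boole, sum_const, nsmul_eq_mul]
  rw [← hcount, Nat.cast_mul]
  field_simp
  ring

theorem abs_sum_delta_sub_le_prod_pow (hp : ∀ i, 0 < p i)
    (hco : Pairwise (Function.onFun Nat.Coprime p)) (hg : ∀ i, Admissible (p i) (g i))
    (ha : ∀ i, DigitRecursion (p i) (g i) (a i)) (W : Fin d → ℕ) {r : ℕ} (hr : r ≠ 0) (s N : ℕ) :
    |∑ n ∈ Ico s (s + N), ((delta (combined p a) n (n + r) : ℝ) - (1 - 1 / (∏ i, p i : ℕ)))| ≤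
      2 * ∏ i, (p i : ℝ) ^ (W i + 1) + ∑ i, (r : ℝ) * (N / (p i : ℝ) ^ W i + 1) := by
  set f : ℕ → ℝ := fun n => delta (combined p a) n (n + r) - (1 - 1 / (∏ i, p i : ℕ))
  have hf (n : ℕ) : |f n| ≤ 1 := abs_delta_sub_le _ _ _ _
  have hmain : |∑ n ∈ Ico s (s + N) with ∀ i, NoCarry (p i ^ W i) r n, f n| ≤
      2 * ∏ i, (p i : ℝ) ^ (W i + 1) := by
    have hle (i) : p i ^ W i ≤ ∏ i, p i ^ (W i + 1) :=
      (Nat.pow_le_pow_right (hp i) (W i).le_succ).trans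
        (single_le_prod' (f := fun i => p i ^ (W i + 1)) (fun i _ => Nat.one_le_pow _ _ (hp i))
          (mem_univ i))
    have hQ : 0 < ∏ i, p i ^ (W i + 1) := prod_pos fun i _ => pow_pos (hp i) _
    rw [sum_filter, two_mul]
    refine (norm_sum_Ico_le_of_forall_window (E := ℝ) (M := ∏ i, p i ^ (W i + 1)) (fun n => ?_) hQ
      (fun t ht => ?_) s (s + N)).trans_eq (by push_cast; rfl)
    · split_ifs
      · exact hf n
      · simp
    · rw [← sum_filter]
      exact sum_delta_sub_filter_noCarry_eq_zero hp hco hg ha hr fun i => (hle i).trans ht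
  have hcarry : |∑ n ∈ Ico s (s + N) with ¬ ∀ i, NoCarry (p i ^ W i) r n, f n| ≤
      ∑ i, (r : ℝ) * (N / (p i : ℝ) ^ W i + 1) :=
    calc _ ≤ ((#{n ∈ Ico s (s + N) | ¬ ∀ i, NoCarry (p i ^ W i) r n} : ℕ) : ℝ) := by
          simpa using (abs_sum_le_sum_abs _ _).trans (sum_le_card_nsmul _ _ _ fun n _ => hf n)
      _ ≤ (∑ i, r * (N / p i ^ W i + 1) : ℕ) := by
          refine Nat.cast_le.2 ?_
          convert card_not_forall_noCarry_le (fun i => p i ^ W i) r s N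
      _ ≤ _ := by
          push_cast
          gcongr with i
          exact_mod_cast Nat.cast_div_le
  rw [← sum_filter_add_sum_filter_not _ fun n => ∀ i, NoCarry (p i ^ W i) r n]
  exact (abs_add_le _ _).trans (add_le_add hmain hcarry)

theorem abs_sum_delta_sub_le (hp : ∀ i, 1 < p i)
    (hco : Pairwise (Function.onFun Nat.Coprime p)) (hg : ∀ i, Admissible (p i) (g i))
    (ha : ∀ i, DigitRecursion (p i) (g i) (a i)) {r : ℕ} (hr : r ≠ 0) (s N : ℕ) {X : ℝ}
    (hX : 1 ≤ X) :
    |∑ n ∈ Ico s (s + N), ((delta (combined p a) n (n + r) : ℝ) - (1 - 1 / (∏ i, p i : ℕ)))| ≤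
      2 * ((∏ i, p i : ℕ) * X ^ d) + d * (r * ((∏ i, p i : ℕ) * (N / X) + 1)) := by
  have hp₀ (i) : 0 < p i := (hp i).pos
  choose W hW hW' using fun i =>
    exists_nat_pow_near hX (by exact_mod_cast hp i : (1 : ℝ) < p i)
  have hprod : ∏ i, (p i : ℝ) ^ (W i + 1) ≤ (∏ i, p i : ℕ) * X ^ d := by
    simp only [pow_succ', prod_mul_distrib, Nat.cast_prod]
    gcongr
    exact (prod_le_prod (fun i _ => by positivity) fun i _ => hW i).trans_eq (by simp)
  have hdiv (i) : (N : ℝ) / p i ^ W i ≤ (∏ i, p i : ℕ) * (N / X) := by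
    have hle : (p i : ℝ) ≤ (∏ i, p i : ℕ) :=
      Nat.cast_le.2 (single_le_prod' (f := p) (fun i _ => hp₀ i) (mem_univ i))
    have hpow : 0 < (p i : ℝ) ^ W i := pow_pos (Nat.cast_pos.2 (hp₀ i)) _
    calc (N : ℝ) / p i ^ W i ≤ p i * (N / X) := by
          rw [mul_div_left_comm, div_eq_mul_inv]
          gcongr
          rw [inv_le_iff_one_le_mul₀ hpow, div_mul_eq_mul_div, one_le_div (by positivity),
            ← pow_succ']
          exact (hW' i).le
      _ ≤ _ := by gcongr
  refine (abs_sum_delta_sub_le_prod_pow hp₀ hco hg ha W hr s N).trans ?_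
  gcongr
  refine (sum_le_card_nsmul univ _ (r * ((∏ i, p i : ℕ) * (N / X) + 1)) fun i _ => ?_).trans_eq
    (by simp)
  gcongr
  exact hdiv i

theorem abs_sum_delta_sub_le_rpow (hd : 0 < d) (hp : ∀ i, 1 < p i)
    (hco : Pairwise (Function.onFun Nat.Coprime p)) (hg : ∀ i, Admissible (p i) (g i))
    (ha : ∀ i, DigitRecursion (p i) (g i) (a i)) {γ : ℝ} (hγ₀ : 0 ≤ γ) (hγd : γ ≤ d) {r : ℕ}
    (hr : r ≠ 0) (s N : ℕ) :
    |∑ n ∈ Ico s (s + N), ((delta (combined p a) n (n + r) : ℝ) - (1 - 1 / (∏ i, p i : ℕ)))| ≤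
      2 * ((∏ i, p i : ℕ) + 1) ^ 2 * (r * (N : ℝ) ^ (1 - γ / d) + (N : ℝ) ^ γ) := by
  rcases N.eq_zero_or_pos with rfl | hN
  · simp only [add_zero, Ico_self, sum_empty, abs_zero]
    positivity
  have hN₁ : (1 : ℝ) ≤ N := Nat.one_le_cast.2 hN
  have hdR : (0 : ℝ) < d := Nat.cast_pos.2 hd
  have hdk : d ≤ ∏ i, p i := by
    simpa using Nat.lt_two_pow_self.le.trans (pow_card_le_prod univ p 2 fun i _ => hp i)
  set k := ∏ i, p i
  set Y := (N : ℝ) ^ (1 - γ / d) with hY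
  have hY₁ : 1 ≤ Y := Real.one_le_rpow hN₁ (sub_nonneg.2 ((div_le_one hdR).2 hγd))
  have hNX : (N : ℝ) / N ^ (γ / d) = Y := by
    rw [hY, Real.rpow_sub (zero_lt_one.trans_le hN₁), Real.rpow_one]
  have hXd : ((N : ℝ) ^ (γ / d)) ^ d = N ^ γ := by
    rw [← Real.rpow_natCast, ← Real.rpow_mul N.cast_nonneg, div_mul_cancel₀ _ hdR.ne']
  calc _ ≤ 2 * (k * (N : ℝ) ^ γ) + d * (r * (k * Y + 1)) := by
        simpa only [hNX, hXd] using abs_sum_delta_sub_le hp hco hg ha hr s N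
          (Real.one_le_rpow hN₁ (by positivity : 0 ≤ γ / d))
    _ ≤ 2 * (k * (N : ℝ) ^ γ) + k * (r * (k * Y + Y)) := by gcongr
    _ = 2 * k * (N : ℝ) ^ γ + k * (k + 1) * (r * Y) := by ring
    _ ≤ 2 * (k + 1) ^ 2 * (N : ℝ) ^ γ + 2 * (k + 1) ^ 2 * (r * Y) := by
        have hk : (0 : ℝ) ≤ k := k.cast_nonneg
        exact add_le_add (mul_le_mul_of_nonneg_right (by nlinarith [hk]) (by positivity))
          (mul_le_mul_of_nonneg_right (by nlinarith [hk]) (by positivity))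
    _ = _ := by ring

end Correlation

end RudinShapiro

open RudinShapiro in
theorem theorem6_general (k : ℕ) :
    ∃ C : ℝ, 0 < C ∧
      ∀ (d : ℕ) (p : Fin d → ℕ), 0 < d → (∀ i, 1 < p i) →
        Pairwise (Function.onFun Nat.Coprime p) → k = ∏ i, p i →
      ∀ (g : (i : Fin d) → Fin (p i) → ℤ → ℤ) (a : Fin d → ℕ → ℤ),
        (∀ i, Admissible (p i) (g i)) → (∀ i, DigitRecursion (p i) (g i) (a i)) →
      ∀ (γ : ℝ), 0 ≤ γ → γ ≤ d →
      ∀ (r₁ r₂ N : ℕ), r₁ < r₂ →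
        |((∑ n ∈ Finset.range N, delta (combined p a) (n + r₁) (n + r₂) : ℕ) : ℝ)
            - (1 - 1 / (k : ℝ)) * (N : ℝ)| ≤
          C * (((r₂ : ℝ) - (r₁ : ℝ)) * (N : ℝ) ^ (1 - γ / (d : ℝ)) + (N : ℝ) ^ γ) := by
  refine ⟨2 * ((k : ℝ) + 1) ^ 2, by positivity, ?_⟩
  rintro d p hd hp hco rfl g a hg ha γ hγ₀ hγd r₁ r₂ N hr
  obtain ⟨r, rfl⟩ := Nat.exists_eq_add_of_le hr.le
  have h := abs_sum_delta_sub_le_rpow hd hp hco hg ha hγ₀ hγd (r := r) (by omega) r₁ N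
  rw [Finset.sum_sub_distrib, Finset.sum_const, Nat.card_Ico, Finset.sum_Ico_eq_sum_range,
    add_tsub_cancel_left, nsmul_eq_mul, mul_comm (N : ℝ)] at h
  simpa only [Nat.cast_sum, Nat.cast_add, add_sub_cancel_right, add_comm r₁, add_right_comm,
    ← add_assoc] using h

theorem theorem6 (k : ℕ) :
    ∃ C : ℝ, 0 < C ∧
      ∀ (d : ℕ) (p : Fin d → ℕ), 2 ≤ d → (∀ i, (p i).Prime) → Function.Injective p →
        k = ∏ i, p i →
      ∀ (g : (i : Fin d) → Fin (p i) → ℤ → ℤ) (a : Fin d → ℕ → ℤ),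
        (∀ i, RudinShapiro.Admissible (p i) (g i)) →
        (∀ i, RudinShapiro.DigitRecursion (p i) (g i) (a i)) →
      ∀ (γ : ℝ), 0 < γ → γ < 1 →
      ∀ (r₁ r₂ N : ℕ), r₁ < r₂ →
        |((∑ n ∈ Finset.range N,
              RudinShapiro.delta (RudinShapiro.combined p a) (n + r₁) (n + r₂) : ℕ) : ℝ)
            - (1 - 1 / (k : ℝ)) * (N : ℝ)| ≤
          C * (((r₂ : ℝ) - (r₁ : ℝ)) * (N : ℝ) ^ (1 - γ / (d : ℝ))
            + ((r₂ : ℝ) - (r₁ : ℝ)) * (N : ℝ) ^ (1 - γ)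
                * Real.posLog ((N : ℝ) ^ (γ / (d : ℝ)) / ((r₂ : ℝ) - (r₁ : ℝ)))
            + (N : ℝ) ^ γ + (r₁ : ℝ)) := by
  obtain ⟨C, hC, h⟩ := theorem6_general k
  refine ⟨C, hC, fun d p hd hp hinj hk g a hg ha γ hγ₀ hγ₁ r₁ r₂ N hr => ?_⟩
  have hco : Pairwise (Function.onFun Nat.Coprime p) := fun i j hij =>
    (Nat.coprime_primes (hp i) (hp j)).2 (hinj.ne hij)
  have hγd : γ ≤ d := hγ₁.le.trans (by exact_mod_cast one_le_two.trans hd)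
  refine (h d p (by omega) (fun i => (hp i).one_lt) hco hk g a hg ha γ hγ₀.le hγd
    r₁ r₂ N hr).trans ?_
  have hlag : (0 : ℝ) ≤ r₂ - r₁ := sub_nonneg.2 (Nat.cast_le.2 hr.le)
  have hlog := mul_nonneg (mul_nonneg hlag (Real.rpow_nonneg N.cast_nonneg (1 - γ)))
    (Real.posLog_nonneg (x := (N : ℝ) ^ (γ / (d : ℝ)) / ((r₂ : ℝ) - (r₁ : ℝ))))
  refine mul_le_mul_of_nonneg_left ?_ hC.le
  linarith [r₁.cast_nonneg (α := ℝ)]
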